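/- \textbf{Theorem (extended Adams' theorem).} Let $B_m$ denote the Bernoulli numbers, $\frac{z}{e^z-1}=\sum_{m\ge 0}B_m\frac{z^m}{m!}$, and let $\varphi$ be Euler's totient function. For a prime $p$, an integer $k\ge 0$ and a rational number $q$ write $p^k\mid q$ if $|q|_p\le p^{-k}$, and $p^k\,\|\,q$ if $p^k\mid q$ and $p^{k+1}\nmid q$. \emph{Definitions.} An odd prime $p$ is \emph{regular} if $p$ divides none of $B_2,B_4,\dots,B_{p-3}$, and \emph{irregular} otherwise. For $m\ge 1$ let $$\Psi_m=\{(p,l): p \text{ an odd prime},\ l \text{ even},\ 2\le l<\varphi(p^m),\ p^m\mid B_l/l\}$$ be the set of irregular pairs of order $m$. Write $(p,s_1,\dots,s_m)\in\widehat\Psi_m$ if $0\le s_\nu<p$ for all $\nu$, $s_1$ is even, $2\le s_1\le p-3$, and $\bigl(p,\sum_{\nu=1}^m s_\nu\varphi(p^{\nu-1})\bigr)\in\Psi_m$. For $(p,l)\in\Psi_1$ let $\Delta_{(p,l)}\in\{0,\dots,p-1\}$ be the residue modulo $p$ of the number $$p^{-1}\left(\frac{B_{l+p-1}}{l+p-1}-\frac{B_l}{l}\right).$$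 If $(p,l)\in\Psi_1$ and $\Delta_{(p,l)}\ne 0$, and $(s_\nu)_{\nu\ge 1}$ is the sequence with $s_1=l$ and $(p,s_1,\dots,s_m)\in\widehat\Psi_m$ for all $m\ge 1$, put $\chi_{(p,l)}=\sum_{\nu\ge 0}s_{\nu+2}\,p^\nu\in\mathbb Z_p$. If $(p,l)\in\Psi_1$ and $\Delta_{(p,l)}=0$, let $T^0_{(p,l)}$ be the rooted tree, each node of which carries a pair $(p,l')$, defined as follows: the root, of height $0$, carries $(p,l)$; a node of height $h$ (its distance from the root) carrying $(p,l')$ has no child if $(p,l')\notin\Psi_{h+2}$, and otherwise has exactly $p$ children, carrying the pairs $(p,l'+j\varphi(p^{h+1}))$, $0\le j<p$. For a positive integer $n\equiv l \pmod{p-1}$ let $$h_0(p,n)=\max\{h\ge 0: T^0_{(p,l)}\text{ has a node of height } h \text{ carrying } (p,\,n \bmod \varphi(p^{h+1}))\}.$$ \emph{Statement.} Let $n$ be an even positive integer and let $p$ be a prime with $p^r\,\|\,n$, $r\ge 1$, and $p-1\nmid n$. Let $l\equiv n\pmod{p-1}$ with $0<l<p-1$. Then $p^{r+\delta}\,\|\,B_n$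 for an integer $\delta\ge 0$, where: \begin{enumerate} \item If $p$ is regular, then $\delta=0$. \item If $p$ is irregular and $(p,l)\notin\Psi_1$, then $\delta=0$. \item If $p$ is irregular, $(p,l)\in\Psi_1$ and $\Delta_{(p,l)}\neq 0$, then the sequence $(s_\nu)$ above exists and is unique, $\chi_{(p,l)}\ne\frac{n-l}{p-1}$, and $\delta=1+\mathrm{ord}_p\left(\chi_{(p,l)}-\frac{n-l}{p-1}\right)$. \item If $p$ is irregular, $(p,l)\in\Psi_1$ and $\Delta_{(p,l)}=0$, then the maximum $h_0(p,n)$ exists and $\delta=1+h_0(p,n)$. \end{enumerate} In cases (3) and (4) the number defining $\Delta_{(p,l)}$ is a $p$-integer. Additionally, in cases (3) and (4), if $(p,l,l)\notin\widehat\Psi_2$ then $\delta=1$, and otherwise $\delta\ge 2$. -/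

import Mathlib

namespace BernoulliStructure

/-- `p ^ k` divides the rational number `q` in the ring of `p`-integral rationals, that is
`|q|_p ≤ p ^ (-k)` (so `k = 0` says that `q` is a `p`-integer). -/
def PowDvd (p k : ℕ) (q : ℚ) : Prop :=
  padicNorm p q ≤ (p : ℚ) ^ (-(k : ℤ))

/-- `p ^ k ∥ q`: the exact power of `p` in the rational number `q` is `p ^ k`. -/
def ExactPowDvd (p k : ℕ) (q : ℚ) : Prop :=
  PowDvd p k q ∧ ¬ PowDvd p (k + 1) q

/-- The divided Bernoulli number `B_m / m`. -/
def dividedBernoulli (m : ℕ) : ℚ :=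
  bernoulli m / (m : ℚ)

/-- An odd prime `p` is regular if it divides none of `B_2, B_4, …, B_{p-3}`. -/
def IsRegularPrime (p : ℕ) : Prop :=
  p.Prime ∧ Odd p ∧ ∀ k : ℕ, Even k → 2 ≤ k → k + 3 ≤ p → ¬ PowDvd p 1 (bernoulli k)

/-- An odd prime is irregular if it is not regular. -/
def IsIrregularPrime (p : ℕ) : Prop :=
  p.Prime ∧ Odd p ∧ ¬ IsRegularPrime p

/-- The set `Ψ_m` of irregular pairs `(p, l)` of order `m`. -/
def irregularPairs (m : ℕ) : Set (ℕ × ℕ) :=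
  {x | x.1.Prime ∧ Odd x.1 ∧ PowDvd x.1 m (dividedBernoulli x.2) ∧
    2 ≤ x.2 ∧ x.2 < Nat.totient (x.1 ^ m) ∧ Even x.2}

/-- The irregular pairs of order `m` belonging to the prime `p`, in `p`-adic notation
`(p, s_1, …, s_m)`. The digits are numbered from `0`, so `s i` stands for `s_{i+1}`. -/
def irregularTuples (p m : ℕ) : Set (Fin m → ℕ) :=
  {s | (∀ i, s i < p) ∧
    (∀ i : Fin m, (i : ℕ) = 0 → Even (s i) ∧ 2 ≤ s i ∧ s i + 3 ≤ p) ∧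
    (p, ∑ i : Fin m, s i * Nat.totient (p ^ (i : ℕ))) ∈ irregularPairs m}

/-- The rational number `p^{-m} (B_{l+φ(p^m)}/(l+φ(p^m)) - B_l/l)`. -/
def deltaQuotient (p m l : ℕ) : ℚ :=
  (dividedBernoulli (l + Nat.totient (p ^ m)) - dividedBernoulli l) / (p : ℚ) ^ m

/-- `Δ_{(p,l)}` for an irregular pair `(p, l)` of order `m`: the residue in `{0, …, p-1}` of the
`p`-integral rational number `deltaQuotient p m l` modulo `p`. -/
def delta (p m l : ℕ) : ℤ :=
  PadicInt.modPart p (deltaQuotient p m l)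

/-- `s = (s_1, s_2, …)` (where `s i` stands for `s_{i+1}`) starts with `s_1 = l`, and each
initial segment `(p, s_1, …, s_m)`, `m ≥ 1`, is an irregular pair of order `m`. -/
def IsIrregularSequence (p l : ℕ) (s : ℕ → ℕ) : Prop :=
  s 0 = l ∧ ∀ m : ℕ, 1 ≤ m → (fun i : Fin m => s i) ∈ irregularTuples p m

/-- The sequence `(s_1, s_2, …)` belonging to `(p, l)` (unique when `Δ_{(p,l)} ≠ 0`). -/
noncomputable def irregularSequence (p l : ℕ) : ℕ → ℕ :=
  Classical.epsilon (IsIrregularSequence p l)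

/-- The characteristic `p`-adic integer `χ_{(p,l)} = ∑_{ν ≥ 0} s_{ν+2} p^ν`. -/
noncomputable def chi (p : ℕ) [Fact p.Prime] (l : ℕ) : ℤ_[p] :=
  ∑' ν : ℕ, (irregularSequence p l (ν + 1) : ℤ_[p]) * (p : ℤ_[p]) ^ ν

/-- The tree `T⁰_{(p,l)}`: `SingularTree p l h l'` says that there is a node of height `h` (that
is, at distance `h` from the root) which contains the pair `(p, l')`. The root contains `(p, l)`.
A node of height `h` with the pair `(p, l')` (of order `h + 1`) has no child if `(p, l')` is not of
order `h + 2`; otherwise it has the `p` children `(p, l' + j φ(p^{h+1}))`, `0 ≤ j < p`. -/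
inductive SingularTree (p l : ℕ) : ℕ → ℕ → Prop
  | root : SingularTree p l 0 l
  | child (h l' j : ℕ) : SingularTree p l h l' → (p, l') ∈ irregularPairs (h + 2) → j < p →
      SingularTree p l (h + 1) (l' + j * Nat.totient (p ^ (h + 1)))

/-- The heights of the nodes of `T⁰_{(p,l)}`, with `l = n mod (p-1)`, that lie on the path
described by `n`: a node of height `h` (order `ν = h + 1`) counts if its pair is
`(p, n mod φ(p^ν))`. -/
def heightSet (p n : ℕ) : Set ℕ :=
  {h | SingularTree p (n % (p - 1)) h (n % Nat.totient (p ^ (h + 1)))}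

/-- The height `h_0(p, n)`. -/
noncomputable def h0 (p n : ℕ) : ℕ :=
  sSup (heightSet p n)

end BernoulliStructure

/-! Since `B_n = n · (B_n / n)`, the exponent `δ` is the `p`-adic order of `B_n / n`. Write `n = l +
k (p - 1)` and let `f k` be `(1 - p ^ (n - 1)) B_n / n`; the Euler factor is a unit, so `δ` is the
order of `f k`. Everything follows from a Kummer congruence: `f (k + d) ≡ f k + d (f 1 - f 0)`
modulo `p ^ 2 d`, with `p ∣ f 1 - f 0` (`IsKummerAffine`).

If `p ∤ f 0`, every `f k` is a unit. Otherwise `Δ = 0` means `p ^ 2 ∣ f 1 - f 0`. When `Δ ≠ 0`, `f k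
- f j` is `p (k - j)` times a unit, so approximate zeros lift uniquely, digit by digit, to `χ`, and
`f k` has order `1 + ord (χ - k)`. When `Δ = 0`, divisibility of `f k` by `p ^ (m + 2)` depends only
on `k` modulo `p ^ m`: the children of a node are all irregular pairs or none, and the tree path of
`n` stops at height `δ - 1`. Finally `p ∣ n` forces `k ≡ l` modulo `p`, which explains the pair `(p,
l, l)`.

The congruence comes from Voronoi's: for `a` prime to `p`, `(a ^ n - 1) (1 - p ^ (n - 1)) B_n / n`
is a limit of sums `∑ w_j u_j ^ k` with `u_j ≡ 1` modulo `p`. Each sum is Kummer-affine by binomial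
expansion, the property survives limits, and `IsKummerAffine.of_mul` divides by the unit `a ^ n -
1`. -/

/-! ### Power sums and Voronoi's congruence -/

open Filter Topology in
theorem tendsto_padic_pow_p (p : ℕ) [Fact p.Prime] :
    Tendsto (fun N : ℕ => (p : ℚ_[p]) ^ N) atTop (𝓝 0) :=
  tendsto_pow_atTop_nhds_zero_of_norm_lt_one Padic.norm_p_lt_one

-- Faulhaber's formula is a polynomial in `p ^ N` without constant term and with linear coefficient
-- `B_n`; the higher terms tend to zero.
open Filter Topology in
theorem tendsto_powerSum_div (p : ℕ) [Fact p.Prime] (n : ℕ) :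
    Tendsto (fun N : ℕ => (∑ j ∈ Finset.range (p ^ N), (j : ℚ_[p]) ^ n) / (p : ℚ_[p]) ^ N) atTop
      (𝓝 (bernoulli n : ℚ_[p])) := by
  have hp0 : (p : ℚ_[p]) ≠ 0 := by exact_mod_cast (Fact.out : p.Prime).ne_zero
  have key : ∀ N : ℕ, (∑ j ∈ Finset.range (p ^ N), (j : ℚ_[p]) ^ n) / (p : ℚ_[p]) ^ N =
      (∑ i ∈ Finset.range n, (bernoulli i : ℚ_[p]) * ((n + 1).choose i) *
        ((p : ℚ_[p]) ^ N) ^ (n - i) / (n + 1)) + bernoulli n := by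
    intro N
    have h := congrArg (fun q : ℚ => (q : ℚ_[p])) (sum_range_pow (p ^ N) n)
    push_cast at h
    rw [h, Finset.sum_range_succ, add_div, Finset.sum_div]
    congr 1
    · refine Finset.sum_congr rfl fun i hi => ?_
      have hi' : n + 1 - i = (n - i) + 1 := by have := Finset.mem_range.mp hi; omega
      rw [hi', pow_succ]
      field_simp
    · have : ((n : ℚ_[p]) + 1) ≠ 0 := by exact_mod_cast Nat.succ_ne_zero n
      simp
      field_simp
  simp_rw [key]
  have h0 : Tendsto (fun N : ℕ => ∑ i ∈ Finset.range n, (bernoulli i : ℚ_[p]) * ((n + 1).choose i) *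
        ((p : ℚ_[p]) ^ N) ^ (n - i) / (n + 1)) atTop (𝓝 (∑ i ∈ Finset.range n, 0)) := by
    refine tendsto_finsetSum _ fun i hi => ?_
    have hi' : n - i ≠ 0 := by have := Finset.mem_range.mp hi; omega
    have := (((tendsto_padic_pow_p p).pow (n - i)).const_mul
      ((bernoulli i : ℚ_[p]) * ((n + 1).choose i))).div_const ((n : ℚ_[p]) + 1)
    simpa [zero_pow hi'] using this
  simpa using h0.add_const (bernoulli n : ℚ_[p])

/-- The natural numbers below `p ^ N` that are not divisible by `p`. -/
def unitResidues (p N : ℕ) : Finset ℕ :=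
  (Finset.range (p ^ N)).filter fun j => ¬ p ∣ j

theorem sum_unitResidues_succ {R : Type*} [CommRing R] (p : ℕ) (hp : 0 < p) (N n : ℕ) :
    ∑ j ∈ unitResidues p (N + 1), (j : R) ^ n =
      ∑ j ∈ Finset.range (p ^ (N + 1)), (j : R) ^ n -
        (p : R) ^ n * ∑ j ∈ Finset.range (p ^ N), (j : R) ^ n := by
  have h1 := Finset.sum_filter_add_sum_filter_not (Finset.range (p ^ (N + 1))) (fun j => p ∣ j)
    (fun j => (j : R) ^ n)
  have h2 : ∑ j ∈ (Finset.range (p ^ (N + 1))).filter (fun j => p ∣ j), (j : R) ^ n =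
      (p : R) ^ n * ∑ j ∈ Finset.range (p ^ N), (j : R) ^ n := by
    rw [Finset.mul_sum]
    symm
    refine Finset.sum_bij (fun j _ => p * j) ?_ ?_ ?_ ?_
    · intro j hj
      have := Finset.mem_range.mp hj
      simp only [Finset.mem_filter, Finset.mem_range, dvd_mul_right, and_true]
      rw [pow_succ']
      exact Nat.mul_lt_mul_of_pos_left this hp
    · intro a _ b _ h
      exact Nat.eq_of_mul_eq_mul_left hp h
    · intro b hb
      obtain ⟨hb1, c, rfl⟩ := Finset.mem_filter.mp hb
      refine ⟨c, ?_, rfl⟩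
      rw [Finset.mem_range, pow_succ'] at hb1
      exact Finset.mem_range.mpr (Nat.lt_of_mul_lt_mul_left hb1)
    · intro j _
      push_cast
      rw [mul_pow]
  rw [← h1, h2]
  simp [unitResidues]

open Filter Topology in
theorem tendsto_unitPowerSum_div (p : ℕ) [Fact p.Prime] (n : ℕ) (hn : 1 ≤ n) :
    Tendsto (fun N : ℕ => (∑ j ∈ unitResidues p (N + 1), (j : ℚ_[p]) ^ n) / (p : ℚ_[p]) ^ (N + 1))
      atTop (𝓝 ((1 - (p : ℚ_[p]) ^ (n - 1)) * bernoulli n)) := by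
  have hp0 : (p : ℚ_[p]) ≠ 0 := by exact_mod_cast (Fact.out : p.Prime).ne_zero
  have h1 := ((tendsto_powerSum_div p n).comp (tendsto_add_atTop_nat 1)).sub
    ((tendsto_powerSum_div p n).const_mul ((p : ℚ_[p]) ^ (n - 1)))
  have : (1 - (p : ℚ_[p]) ^ (n - 1)) * bernoulli n =
    bernoulli n - (p : ℚ_[p]) ^ (n - 1) * bernoulli n := by ring
  rw [this]
  refine h1.congr fun N => ?_
  rw [sum_unitResidues_succ p (Fact.out : p.Prime).pos]
  obtain ⟨m, rfl⟩ : ∃ m, n = m + 1 := ⟨n - 1, by omega⟩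
  simp only [Function.comp, Nat.add_sub_cancel]
  field_simp
  ring

theorem sum_unitResidues_mul_mod {R : Type*} [CommRing R] (p : ℕ) [Fact p.Prime] (N n a : ℕ)
    (ha : ¬ p ∣ a) :
    ∑ j ∈ unitResidues p (N + 1), ((a * j % p ^ (N + 1) : ℕ) : R) ^ n =
      ∑ j ∈ unitResidues p (N + 1), (j : R) ^ n := by
  have hp : p.Prime := Fact.out
  have hmaps : ∀ j ∈ unitResidues p (N + 1), a * j % p ^ (N + 1) ∈ unitResidues p (N + 1) := by
    intro j hj
    obtain ⟨_, hj2⟩ := Finset.mem_filter.mp hj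
    refine Finset.mem_filter.mpr ⟨Finset.mem_range.mpr (Nat.mod_lt _ (pow_pos hp.pos _)), ?_⟩
    rw [Nat.dvd_mod_iff (dvd_pow_self p (Nat.succ_ne_zero N)), hp.dvd_mul]
    tauto
  have hinj : Set.InjOn (fun j => a * j % p ^ (N + 1)) (unitResidues p (N + 1)) := by
    intro x hx y hy h
    have hx1 := Finset.mem_range.mp (Finset.mem_filter.mp hx).1
    have hy1 := Finset.mem_range.mp (Finset.mem_filter.mp hy).1
    have hc : Nat.gcd (p ^ (N + 1)) a = 1 :=
      Nat.Coprime.pow_left _ ((Nat.Prime.coprime_iff_not_dvd hp).mpr ha)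
    have := Nat.ModEq.cancel_left_of_coprime hc h
    exact Nat.ModEq.eq_of_lt_of_lt this hx1 hy1
  have himg : (unitResidues p (N + 1)).image (fun j => a * j % p ^ (N + 1)) =
      unitResidues p (N + 1) :=
    Finset.eq_of_subset_of_card_le (Finset.image_subset_iff.mpr hmaps)
      (by rw [Finset.card_image_of_injOn hinj])
  conv_rhs => rw [← himg]
  rw [Finset.sum_image hinj]

/-- The sum `∑ ⌊aj/p^N⌋ (aj)^(n-1)` over the `j < p ^ N` prime to `p`. -/
def voronoiSum (R : Type*) [CommRing R] (p a N n : ℕ) : R :=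
  ∑ j ∈ unitResidues p N, ((a * j / p ^ N : ℕ) : R) * ((a * j : ℕ) : R) ^ (n - 1)

theorem sq_dvd_sub_pow_sub {R : Type*} [CommRing R] (x y : R) (n : ℕ) :
    y ^ 2 ∣ (x - y) ^ n - x ^ n + n * y * x ^ (n - 1) := by
  obtain ⟨k, hk⟩ := (Polynomial.X ^ n : Polynomial R).binomExpansion x (-y)
  simp only [Polynomial.eval_pow, Polynomial.eval_X, Polynomial.derivative_X_pow,
    Polynomial.eval_mul, Polynomial.eval_natCast, map_natCast] at hk
  refine ⟨k, ?_⟩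
  rw [sub_eq_add_neg x y, hk]
  ring

/-- Subtract the multiple `p ^ (N + 1) ⌊aj / p ^ (N + 1)⌋` from `aj`, expand the `n`-th power to
first order and sum; the remainders of the `aj` permute the unit residues. -/
theorem pow_dvd_voronoi (p : ℕ) [Fact p.Prime] (N n a : ℕ) (ha : ¬ p ∣ a) :
    ((p : ℤ) ^ (N + 1)) ^ 2 ∣ ((a : ℤ) ^ n - 1) * ∑ j ∈ unitResidues p (N + 1), (j : ℤ) ^ n -
      n * (p : ℤ) ^ (N + 1) * voronoiSum ℤ p a (N + 1) n := by
  have h : ((p : ℤ) ^ (N + 1)) ^ 2 ∣ ∑ j ∈ unitResidues p (N + 1),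
      (((a * j % p ^ (N + 1) : ℕ) : ℤ) ^ n - ((a * j : ℕ) : ℤ) ^ n +
        n * (p : ℤ) ^ (N + 1) * (((a * j / p ^ (N + 1) : ℕ) : ℤ) * ((a * j : ℕ) : ℤ) ^ (n - 1))) := by
    refine Finset.dvd_sum fun j _ => ?_
    have h1 : ((a * j % p ^ (N + 1) : ℕ) : ℤ) =
        ((a * j : ℕ) : ℤ) - (p : ℤ) ^ (N + 1) * ((a * j / p ^ (N + 1) : ℕ) : ℤ) := by
      have := congrArg (Nat.cast : ℕ → ℤ) (Nat.mod_add_div (a * j) (p ^ (N + 1)))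
      push_cast at this ⊢
      linarith
    rw [h1]
    refine (Dvd.intro _ (mul_pow _ _ 2).symm).trans ((sq_dvd_sub_pow_sub ((a * j : ℕ) : ℤ)
      ((p : ℤ) ^ (N + 1) * ((a * j / p ^ (N + 1) : ℕ) : ℤ)) n).trans (dvd_of_eq ?_))
    ring
  rw [Finset.sum_add_distrib, Finset.sum_sub_distrib, sum_unitResidues_mul_mod p N n a ha,
    ← Finset.mul_sum] at h
  rw [← dvd_neg]
  refine h.trans (dvd_of_eq ?_)
  simp only [Nat.cast_mul, mul_pow, ← Finset.mul_sum, voronoiSum]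
  ring

open Filter Topology in
theorem tendsto_voronoiSum (p : ℕ) [Fact p.Prime] (n a : ℕ) (hn : 1 ≤ n) (ha : ¬ p ∣ a) :
    Tendsto (fun N : ℕ => voronoiSum ℚ_[p] p a (N + 1) n) atTop
      (𝓝 (((a : ℚ_[p]) ^ n - 1) * ((1 - (p : ℚ_[p]) ^ (n - 1)) * bernoulli n) / n)) := by
  have hp0 : (p : ℚ_[p]) ≠ 0 := by exact_mod_cast (Fact.out : p.Prime).ne_zero
  have hn0 : (n : ℚ_[p]) ≠ 0 := by exact_mod_cast (by omega : n ≠ 0)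
  have h1 := (tendsto_unitPowerSum_div p n hn).const_mul ((a : ℚ_[p]) ^ n - 1)
  choose c hc using fun N => pow_dvd_voronoi p N n a ha
  have h2 : Tendsto (fun N : ℕ => (p : ℚ_[p]) ^ (N + 1) * (c N : ℚ_[p])) atTop (𝓝 0) := by
    refine squeeze_zero_norm (a := fun N => ‖(p : ℚ_[p]) ^ (N + 1)‖) (fun N => ?_) ?_
    · rw [norm_mul]
      exact mul_le_of_le_one_right (norm_nonneg _) (Padic.norm_int_le_one _)
    · simpa using ((tendsto_padic_pow_p p).comp (tendsto_add_atTop_nat 1)).norm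
  have h3 := (h1.sub h2).div_const (n : ℚ_[p])
  rw [sub_zero] at h3
  refine h3.congr fun N => ?_
  have h4 := congrArg (Int.cast : ℤ → ℚ_[p]) (hc N)
  have h5 : voronoiSum ℚ_[p] p a (N + 1) n = ((voronoiSum ℤ p a (N + 1) n : ℤ) : ℚ_[p]) := by
    simp only [voronoiSum, Int.cast_sum, Int.cast_mul, Int.cast_pow, Int.cast_natCast]
  rw [h5]
  push_cast at h4
  field_simp
  linear_combination h4

/-! ### Kummer-affine functions -/

/-- A function `f : ℕ → ℤ_p` which modulo `p ^ 2` times the increment of the argument is affine,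
with a slope divisible by `p`. -/
structure IsKummerAffine (p : ℕ) [Fact p.Prime] (f : ℕ → ℤ_[p]) : Prop where
  slope : (p : ℤ_[p]) ∣ f 1 - f 0
  affine : ∀ k d : ℕ, (p : ℤ_[p]) ^ 2 * d ∣ f (k + d) - f k - d * (f 1 - f 0)

/-- If `p ^ e` is the exact power in `i`, then `e ≤ i - 2`, as otherwise `i ≥ 3 ^ (i - 1) > i`. It
fails for `p = i = 2`. -/
theorem natCast_dvd_pow_sub_two (p : ℕ) [Fact p.Prime] (hp : 3 ≤ p) (i : ℕ) (hi : 2 ≤ i) :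
    (i : ℤ_[p]) ∣ (p : ℤ_[p]) ^ (i - 2) := by
  have hpp : p.Prime := Fact.out
  obtain ⟨e, m, hm, rfl⟩ := Nat.exists_eq_pow_mul_and_not_dvd (n := i) (by omega) p hpp.ne_one
  set i := p ^ e * m with hidef
  have hm0 : m ≠ 0 := fun h => hm (h ▸ dvd_zero p)
  have he : e ≤ i - 2 := by
    by_contra hlt
    have h1 : p ^ e ≤ i := Nat.le_mul_of_pos_right _ (Nat.pos_of_ne_zero hm0)
    have h2 : 3 ^ (i - 1) ≤ p ^ e :=
      (Nat.pow_le_pow_left hp _).trans (Nat.pow_le_pow_right hpp.pos (by omega))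
    have h3 : ∀ t : ℕ, t + 2 < 3 ^ (t + 1) := by
      intro t
      induction t with
      | zero => norm_num
      | succ t ih => rw [pow_succ]; omega
    have h4 := h3 (i - 2)
    rw [show i - 2 + 1 = i - 1 by omega] at h4
    omega
  have hu : IsUnit (m : ℤ_[p]) := by
    rw [PadicInt.isUnit_iff, PadicInt.norm_natCast_eq_one_iff]
    exact (Nat.Prime.coprime_iff_not_dvd hpp).mpr hm
  rw [hidef]
  push_cast
  rw [hu.mul_right_dvd]
  exact pow_dvd_pow _ he

/-- In the binomial expansion of `(1 + p t) ^ d`, use `i · C(d, i) = d · C(d - 1, i - 1)`; for `i ≥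
2` the denominator `i` is absorbed by `p ^ (i - 2)`, leaving `p ^ 2 d`. -/
theorem sq_mul_dvd_pow_sub (p : ℕ) [Fact p.Prime] (hp : 3 ≤ p) (u : ℤ_[p])
    (hu : (p : ℤ_[p]) ∣ u - 1) (d : ℕ) :
    (p : ℤ_[p]) ^ 2 * d ∣ u ^ d - 1 - d * (u - 1) := by
  obtain ⟨t, ht⟩ := hu
  obtain rfl : u = p * t + 1 := by linear_combination ht
  rcases d with _ | d
  · simp
  rw [add_pow, Finset.sum_range_succ', Finset.sum_range_succ']
  have h : (p : ℤ_[p]) ^ 2 * ((d + 1 : ℕ) : ℤ_[p]) ∣ ∑ k ∈ Finset.range d,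
      ((p : ℤ_[p]) * t) ^ (k + 1 + 1) * 1 ^ (d + 1 - (k + 1 + 1)) * ((d + 1).choose (k + 1 + 1)) := by
    refine Finset.dvd_sum fun k _ => ?_
    obtain ⟨y, hy⟩ := natCast_dvd_pow_sub_two p hp (k + 2) (by omega)
    have hc := congrArg (Nat.cast : ℕ → ℤ_[p]) (Nat.add_one_mul_choose_eq d (k + 1))
    rw [show k + 2 - 2 = k by omega] at hy
    push_cast at hc hy ⊢
    refine ⟨y * t ^ (k + 2) * (d.choose (k + 1)), ?_⟩
    rw [one_pow, mul_one, mul_pow, show (p : ℤ_[p]) ^ (k + 1 + 1) = p ^ 2 * p ^ k by ring, hy]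
    linear_combination (-(p : ℤ_[p]) ^ 2 * y * t ^ (k + 2)) * hc
  convert h using 1
  push_cast
  simp
  ring

theorem isKummerAffine_sum (p : ℕ) [Fact p.Prime] (hp : 3 ≤ p) {ι : Type*} (s : Finset ι)
    (w u : ι → ℤ_[p]) (hu : ∀ i ∈ s, (p : ℤ_[p]) ∣ u i - 1) :
    IsKummerAffine p fun k => ∑ i ∈ s, w i * u i ^ k := by
  constructor
  · rw [← Finset.sum_sub_distrib]
    refine Finset.dvd_sum fun i hi => ?_
    rw [pow_one, pow_zero, ← mul_sub]
    exact (hu i hi).mul_left _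
  · intro k d
    rw [← Finset.sum_sub_distrib, ← Finset.sum_sub_distrib, Finset.mul_sum,
      ← Finset.sum_sub_distrib]
    refine Finset.dvd_sum fun i hi => ?_
    obtain ⟨a, ha⟩ := sq_mul_dvd_pow_sub p hp (u i) (hu i hi) d
    obtain ⟨b, hb⟩ := hu i hi
    obtain ⟨c, hc⟩ := (hu i hi).trans (sub_one_dvd_pow_sub_one (u i) k)
    refine ⟨w i * (u i ^ k * a + c * b), ?_⟩
    rw [pow_add]
    linear_combination (w i * u i ^ k) * ha + (w i * d * (u i - 1)) * hc + (w i * d * p * c) * hb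

theorem PadicInt.dvd_iff_norm_le (p : ℕ) [Fact p.Prime] (x y : ℤ_[p]) : x ∣ y ↔ ‖y‖ ≤ ‖x‖ := by
  constructor
  · rintro ⟨c, rfl⟩
    rw [norm_mul]
    exact mul_le_of_le_one_right (norm_nonneg _) (PadicInt.norm_le_one c)
  · intro h
    rcases eq_or_ne x 0 with rfl | hx
    · rw [norm_zero] at h
      simp [norm_le_zero_iff.mp h]
    · have hx' : (x : ℚ_[p]) ≠ 0 := PadicInt.coe_ne_zero.mpr hx
      refine ⟨⟨(y : ℚ_[p]) / x, ?_⟩, ?_⟩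
      · rw [norm_div]
        exact div_le_one_of_le₀ h (norm_nonneg _)
      · apply PadicInt.ext
        show (y : ℚ_[p]) = (x : ℚ_[p]) * ((y : ℚ_[p]) / x)
        field_simp

open Filter Topology in
theorem PadicInt.dvd_of_tendsto (p : ℕ) [Fact p.Prime] (c x : ℤ_[p]) (g : ℕ → ℤ_[p])
    (hg : Tendsto g atTop (𝓝 x)) (h : ∀ N, c ∣ g N) : c ∣ x := by
  rw [PadicInt.dvd_iff_norm_le]
  exact le_of_tendsto hg.norm (Eventually.of_forall fun N => (PadicInt.dvd_iff_norm_le p _ _).mp (h N))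

open Filter Topology in
theorem IsKummerAffine.of_tendsto (p : ℕ) [Fact p.Prime] (g : ℕ → ℕ → ℤ_[p]) (f : ℕ → ℤ_[p])
    (hg : ∀ N, IsKummerAffine p (g N)) (h : ∀ k, Tendsto (fun N => g N k) atTop (𝓝 (f k))) :
    IsKummerAffine p f where
  slope := PadicInt.dvd_of_tendsto p _ _ _ ((h 1).sub (h 0)) fun N => (hg N).slope
  affine k d := PadicInt.dvd_of_tendsto p _ _ _
    (((h (k + d)).sub (h k)).sub (((h 1).sub (h 0)).const_mul (d : ℤ_[p])))
    fun N => (hg N).affine k d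

section
variable {p : ℕ} [Fact p.Prime] {f : ℕ → ℤ_[p]}

theorem IsKummerAffine.mul_dvd_sub (hf : IsKummerAffine p f) (k d : ℕ) :
    (p : ℤ_[p]) * d ∣ f (k + d) - f k := by
  obtain ⟨a, ha⟩ := hf.slope
  obtain ⟨b, hb⟩ := hf.affine k d
  exact ⟨p * b + a, by linear_combination hb + d * ha⟩

theorem IsKummerAffine.dvd_sub (hf : IsKummerAffine p f) (k d : ℕ) :
    (p : ℤ_[p]) ∣ f (k + d) - f k :=
  (dvd_mul_right _ _).trans (hf.mul_dvd_sub k d)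

/-- Solve the product rule for `f`. The leftover cross terms are `d` times a product of one
increment of `e` and one of `f`, both divisible by `p`; hence `f` is first shown to be constant
modulo `p`. -/
theorem IsKummerAffine.of_mul {e : ℕ → ℤ_[p]} (he : IsKummerAffine p e)
    (hu : ∀ k, IsUnit (e k)) (hg : IsKummerAffine p fun k => e k * f k) : IsKummerAffine p f := by
  have hf0 : ∀ k, (p : ℤ_[p]) ∣ f k - f 0 := by
    intro k
    rw [← (hu k).dvd_mul_left]
    obtain ⟨a, ha⟩ := hg.dvd_sub 0 k
    obtain ⟨b, hb⟩ := he.dvd_sub 0 k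
    rw [zero_add] at ha hb
    exact ⟨a - f 0 * b, by linear_combination ha - f 0 * hb⟩
  refine ⟨hf0 1, fun k d => ?_⟩
  rw [← (hu (k + d)).dvd_mul_left]
  obtain ⟨A, hA⟩ := hg.affine k d
  obtain ⟨B, hB⟩ := he.affine k d
  obtain ⟨α, hα⟩ := he.dvd_sub 0 (k + d)
  obtain ⟨β, hβ⟩ := hf0 1
  obtain ⟨γ, hγ⟩ := hf0 k
  obtain ⟨ε, hε⟩ := he.slope
  rw [zero_add] at hα
  refine ⟨A - f k * B + (ε - α) * β - γ * ε, ?_⟩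
  linear_combination hA - f k * hB + d * (f 1 - f 0) * (hε - hα) + d * p * (ε - α) * hβ -
    d * (e 1 - e 0) * hγ - d * p * γ * hε

end

/-! ### Kummer congruences for divided Bernoulli numbers -/

theorem dvd_pow_pred_sub_one (p : ℕ) [Fact p.Prime] (m : ℕ) (hm : ¬ p ∣ m) :
    (p : ℤ_[p]) ∣ (m : ℤ_[p]) ^ (p - 1) - 1 := by
  have hpp : p.Prime := Fact.out
  have hc : IsCoprime (m : ℤ) p :=
    Nat.isCoprime_iff_coprime.mpr ((Nat.Prime.coprime_iff_not_dvd hpp).mpr hm).symm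
  obtain ⟨c, hc⟩ := (Int.ModEq.pow_card_sub_one_eq_one hpp hc).symm.dvd
  refine ⟨c, ?_⟩
  exact_mod_cast congrArg (Int.cast : ℤ → ℤ_[p]) hc

theorem isKummerAffine_voronoiSum (p : ℕ) [Fact p.Prime] (hp : 3 ≤ p) (a N l : ℕ)
    (ha : ¬ p ∣ a) (hl : 1 ≤ l) :
    IsKummerAffine p fun k => voronoiSum ℤ_[p] p a N (l + k * (p - 1)) := by
  have hpp : p.Prime := Fact.out
  have h := isKummerAffine_sum p hp (unitResidues p N)
    (fun j => ((a * j / p ^ N : ℕ) : ℤ_[p]) * ((a * j : ℕ) : ℤ_[p]) ^ (l - 1))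
    (fun j => ((a * j : ℕ) : ℤ_[p]) ^ (p - 1)) (fun j hj => by
      refine dvd_pow_pred_sub_one p (a * j) ?_
      have := (Finset.mem_filter.mp hj).2
      rw [hpp.dvd_mul]
      tauto)
  convert h using 3 with k
  refine Finset.sum_congr rfl fun j _ => ?_
  rw [show l + k * (p - 1) - 1 = (l - 1) + (p - 1) * k by
    rw [mul_comm]; omega, pow_add, pow_mul, mul_assoc]

theorem exists_not_dvd_pow_sub_one (p : ℕ) [Fact p.Prime] (l : ℕ) (hl : ¬ (p - 1) ∣ l) :
    ∃ a : ℕ, ¬ p ∣ a ∧ ¬ (p : ℤ) ∣ (a : ℤ) ^ l - 1 := by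
  have h := (FiniteField.forall_pow_eq_one_iff (ZMod p) l).not.mpr
    (by rwa [ZMod.card])
  push Not at h
  obtain ⟨x, hx⟩ := h
  refine ⟨(x : ZMod p).val, ?_, ?_⟩
  · rw [← ZMod.natCast_eq_zero_iff, ZMod.natCast_zmod_val]
    exact x.ne_zero
  · rw [← ZMod.intCast_zmod_eq_zero_iff_dvd]
    push_cast
    rw [ZMod.natCast_zmod_val, sub_eq_zero]
    intro h
    exact hx (Units.ext (by simpa using h))

open Filter Topology in
/-- Kummer congruences: the divided Bernoulli numbers without their Euler factors. -/
theorem exists_isKummerAffine_bernoulli (p : ℕ) [Fact p.Prime] (hp : 3 ≤ p) (l : ℕ)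
    (hl1 : 1 ≤ l) (hl : ¬ (p - 1) ∣ l) :
    ∃ f : ℕ → ℤ_[p], IsKummerAffine p f ∧ ∀ k, (f k : ℚ_[p]) =
      (1 - (p : ℚ_[p]) ^ (l + k * (p - 1) - 1)) *
        (bernoulli (l + k * (p - 1)) / (l + k * (p - 1) : ℕ)) := by
  obtain ⟨a, ha, hal⟩ := exists_not_dvd_pow_sub_one p l hl
  set e : ℕ → ℤ_[p] := fun k => (a : ℤ_[p]) ^ (l + k * (p - 1)) - 1 with hedef
  have he : IsKummerAffine p e := by
    -- Two terms suffice: `a ^ l · (a ^ (p - 1)) ^ k` and `-1 · 1 ^ k`.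
    have h := isKummerAffine_sum p hp (Finset.univ : Finset (Fin 2)) ![(a : ℤ_[p]) ^ l, -1]
      ![(a : ℤ_[p]) ^ (p - 1), 1] (by
        intro i _
        fin_cases i
        · exact dvd_pow_pred_sub_one p a ha
        · simp)
    convert h using 2 with k
    simp only [Fin.sum_univ_two, hedef, Matrix.cons_val_zero, Matrix.cons_val_one]
    rw [pow_add, mul_comm k, pow_mul]
    simp
    ring
  have hu : ∀ k, IsUnit (e k) := by
    intro k
    by_contra hk
    rw [PadicInt.not_isUnit_iff, PadicInt.norm_lt_one_iff_dvd] at hk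
    have h0 : (p : ℤ_[p]) ∣ e 0 := by
      have := _root_.dvd_sub hk (he.dvd_sub 0 k)
      simpa using this
    apply hal
    rw [← pow_one (p : ℤ), ← PadicInt.pow_p_dvd_int_iff, pow_one]
    simpa [hedef] using h0
  choose v hv using fun k => (hu k)
  have hlim := fun k => tendsto_voronoiSum p (l + k * (p - 1)) a (by omega) ha
  have hcoe : ∀ N n, voronoiSum ℚ_[p] p a N n = ((voronoiSum ℤ_[p] p a N n : ℤ_[p]) : ℚ_[p]) := by
    intro N n
    simp [voronoiSum, PadicInt.coe_sum]
  have hG : ∀ k, ∃ g : ℤ_[p], (g : ℚ_[p]) = ((a : ℚ_[p]) ^ (l + k * (p - 1)) - 1) *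
      ((1 - (p : ℚ_[p]) ^ (l + k * (p - 1) - 1)) * bernoulli (l + k * (p - 1))) /
        (l + k * (p - 1) : ℕ) := by
    intro k
    -- Integrality holds because the value is a limit of `p`-adic integers.
    refine ⟨⟨_, ?_⟩, rfl⟩
    refine le_of_tendsto (hlim k).norm (Eventually.of_forall fun N => ?_)
    rw [hcoe]
    exact PadicInt.norm_le_one _
  choose g hg using hG
  have hgK : IsKummerAffine p g := by
    refine IsKummerAffine.of_tendsto p
      (fun N k => voronoiSum ℤ_[p] p a (N + 1) (l + k * (p - 1))) g
      (fun N => isKummerAffine_voronoiSum p hp a (N + 1) l ha hl1) fun k => ?_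
    refine tendsto_subtype_rng.mpr ?_
    rw [hg k]
    simpa only [← hcoe] using hlim k
  refine ⟨fun k => ((v k)⁻¹ : ℤ_[p]ˣ) * g k, IsKummerAffine.of_mul he hu ?_, fun k => ?_⟩
  · convert hgK using 2 with k
    rw [← hv k, Units.mul_inv_cancel_left]
  · have h1 : (e k : ℚ_[p]) * ((((v k)⁻¹ : ℤ_[p]ˣ) * g k : ℤ_[p]) : ℚ_[p]) = (g k : ℚ_[p]) := by
      rw [← PadicInt.coe_mul, ← hv k, Units.mul_inv_cancel_left]
    have h2 : (e k : ℚ_[p]) ≠ 0 := PadicInt.coe_ne_zero.mpr (hu k).ne_zero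
    apply mul_left_cancel₀ h2
    rw [h1, hg k]
    simp only [hedef]
    push_cast
    ring

/-! ### Exact powers of `p` and non-vanishing -/

theorem PadicInt.pow_dvd_iff_norm_le (p : ℕ) [Fact p.Prime] (m : ℕ) (x : ℤ_[p]) :
    (p : ℤ_[p]) ^ m ∣ x ↔ ‖x‖ ≤ (p : ℝ) ^ (-(m : ℤ)) := by
  rw [PadicInt.dvd_iff_norm_le, PadicInt.norm_p_pow]

/-- Otherwise Euler's formula would make `ζ` vanish at an even integer at least 2. This is what
makes `δ` finite. -/
theorem bernoulli_ne_zero_of_even (n : ℕ) (hn : Even n) (hn0 : 0 < n) : bernoulli n ≠ 0 := by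
  obtain ⟨k, rfl⟩ := hn
  intro h
  have hz := riemannZeta_two_mul_nat (k := k) (by omega)
  rw [two_mul k, h] at hz
  refine riemannZeta_ne_zero_of_one_lt_re (s := 2 * (k : ℂ)) ?_ (by simpa using hz)
  have : (1 : ℝ) ≤ k := by exact_mod_cast (by omega : 1 ≤ k)
  simp
  linarith

theorem natCast_pow_dvd_sub_iff (p : ℕ) [Fact p.Prime] (m k j : ℕ) :
    (p : ℤ_[p]) ^ m ∣ (k : ℤ_[p]) - j ↔ j ≡ k [MOD p ^ m] := by
  rw [Nat.modEq_iff_dvd]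
  have := PadicInt.pow_p_dvd_int_iff (p := p) m ((k : ℤ) - j)
  push_cast at this ⊢
  exact this

theorem PadicInt.valuation_eq_of_dvd (p : ℕ) [Fact p.Prime] (m : ℕ) (x : ℤ_[p])
    (h1 : (p : ℤ_[p]) ^ m ∣ x) (h2 : ¬ (p : ℤ_[p]) ^ (m + 1) ∣ x) : x.valuation = m := by
  have hx : x ≠ 0 := by
    rintro rfl
    exact h2 (dvd_zero _)
  rw [← Ideal.mem_span_singleton, PadicInt.mem_span_pow_iff_le_valuation x hx] at h1 h2
  omega

theorem PadicInt.exists_exact_pow_dvd (p : ℕ) [Fact p.Prime] (x : ℤ_[p]) (hx : x ≠ 0) :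
    ∃ m : ℕ, (p : ℤ_[p]) ^ m ∣ x ∧ ¬ (p : ℤ_[p]) ^ (m + 1) ∣ x := by
  refine ⟨x.valuation, ?_, ?_⟩
  · rw [← Ideal.mem_span_singleton, PadicInt.mem_span_pow_iff_le_valuation x hx]
  · rw [← Ideal.mem_span_singleton, PadicInt.mem_span_pow_iff_le_valuation x hx]
    omega

/-! ### Zeros of Kummer-affine functions modulo powers of `p` -/

namespace IsKummerAffine
variable {p : ℕ} [Fact p.Prime] {f : ℕ → ℤ_[p]}

theorem mul_sub_dvd_sub (hf : IsKummerAffine p f) (k j : ℕ) :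
    (p : ℤ_[p]) * ((k : ℤ_[p]) - j) ∣ f k - f j := by
  rcases le_total j k with h | h
  · obtain ⟨d, rfl⟩ := Nat.exists_eq_add_of_le h
    simpa using hf.mul_dvd_sub j d
  · obtain ⟨d, rfl⟩ := Nat.exists_eq_add_of_le h
    rw [← dvd_neg]
    simpa using hf.mul_dvd_sub k d

theorem sq_mul_sub_dvd_sub (hf : IsKummerAffine p f) (h2 : (p : ℤ_[p]) ^ 2 ∣ f 1 - f 0)
    (k j : ℕ) : (p : ℤ_[p]) ^ 2 * ((k : ℤ_[p]) - j) ∣ f k - f j := by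
  have key : ∀ k d : ℕ, (p : ℤ_[p]) ^ 2 * d ∣ f (k + d) - f k := by
    intro k d
    obtain ⟨a, ha⟩ := h2
    obtain ⟨b, hb⟩ := hf.affine k d
    exact ⟨b + a, by linear_combination hb + d * ha⟩
  rcases le_total j k with h | h
  · obtain ⟨d, rfl⟩ := Nat.exists_eq_add_of_le h
    simpa using key j d
  · obtain ⟨d, rfl⟩ := Nat.exists_eq_add_of_le h
    rw [← dvd_neg]
    simpa using key k d

theorem pow_dvd_iff_of_modEq (hf : IsKummerAffine p f) {k j m : ℕ} (h : k ≡ j [MOD p ^ m]) :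
    (p : ℤ_[p]) ^ (m + 1) ∣ f k ↔ (p : ℤ_[p]) ^ (m + 1) ∣ f j := by
  have h1 := (natCast_pow_dvd_sub_iff p m j k).mpr h
  have h2 := (mul_dvd_mul_left (p : ℤ_[p]) h1).trans (hf.mul_sub_dvd_sub j k)
  rw [← pow_succ'] at h2
  exact (dvd_iff_dvd_of_dvd_sub h2).symm

theorem pow_dvd_iff_of_modEq_of_sq_dvd (hf : IsKummerAffine p f)
    (hs : (p : ℤ_[p]) ^ 2 ∣ f 1 - f 0) {k j m : ℕ} (h : k ≡ j [MOD p ^ m]) :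
    (p : ℤ_[p]) ^ (m + 2) ∣ f k ↔ (p : ℤ_[p]) ^ (m + 2) ∣ f j := by
  have h1 := (natCast_pow_dvd_sub_iff p m j k).mpr h
  have h2 := (mul_dvd_mul_left ((p : ℤ_[p]) ^ 2) h1).trans (hf.sq_mul_sub_dvd_sub hs j k)
  rw [← pow_add, add_comm 2 m] at h2
  exact (dvd_iff_dvd_of_dvd_sub h2).symm

theorem exists_isUnit_slope (hf : IsKummerAffine p f) (hs : ¬ (p : ℤ_[p]) ^ 2 ∣ f 1 - f 0) :
    ∃ c : ℤ_[p], IsUnit c ∧ f 1 - f 0 = p * c := by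
  obtain ⟨c, hc⟩ := hf.slope
  refine ⟨c, ?_, hc⟩
  by_contra h
  rw [PadicInt.not_isUnit_iff, PadicInt.norm_lt_one_iff_dvd] at h
  apply hs
  rw [hc, sq]
  exact mul_dvd_mul_left _ h

/-- With `f 1 - f 0 = p c`, the quotient by `p d` of an increment over a step `d` is `c` plus a
multiple of `p`, so it is a unit along with `c`. -/
theorem exists_isUnit_sub_eq (hf : IsKummerAffine p f) (hs : ¬ (p : ℤ_[p]) ^ 2 ∣ f 1 - f 0)
    (k j : ℕ) : ∃ v : ℤ_[p], IsUnit v ∧ f k - f j = p * ((k : ℤ_[p]) - j) * v := by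
  obtain ⟨c, hc, hc'⟩ := hf.exists_isUnit_slope hs
  have key : ∀ k d : ℕ, ∃ v : ℤ_[p], IsUnit v ∧ f (k + d) - f k = p * d * v := by
    intro k d
    obtain ⟨b, hb⟩ := hf.affine k d
    refine ⟨c + p * b, ?_, by linear_combination hb + d * hc'⟩
    by_contra h
    rw [PadicInt.not_isUnit_iff, PadicInt.norm_lt_one_iff_dvd, dvd_add_left (dvd_mul_right _ _),
      ← PadicInt.norm_lt_one_iff_dvd, ← PadicInt.not_isUnit_iff] at h
    exact h hc
  rcases le_total j k with h | h
  · obtain ⟨d, rfl⟩ := Nat.exists_eq_add_of_le h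
    obtain ⟨v, hv, h'⟩ := key j d
    exact ⟨v, hv, by rw [h']; push_cast; ring⟩
  · obtain ⟨d, rfl⟩ := Nat.exists_eq_add_of_le h
    obtain ⟨v, hv, h'⟩ := key k d
    exact ⟨v, hv, by push_cast; linear_combination -h'⟩

theorem modEq_of_pow_dvd (hf : IsKummerAffine p f) (hs : ¬ (p : ℤ_[p]) ^ 2 ∣ f 1 - f 0)
    {k j m : ℕ} (hk : (p : ℤ_[p]) ^ (m + 1) ∣ f k) (hj : (p : ℤ_[p]) ^ (m + 1) ∣ f j) :
    k ≡ j [MOD p ^ m] := by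
  obtain ⟨v, hv, h⟩ := hf.exists_isUnit_sub_eq hs j k
  have h1 := _root_.dvd_sub hj hk
  rw [h, hv.dvd_mul_right, pow_succ', mul_dvd_mul_iff_left PadicInt.prime_p.ne_zero,
    natCast_pow_dvd_sub_iff] at h1
  exact h1

theorem exists_pow_dvd (hf : IsKummerAffine p f) (hs : ¬ (p : ℤ_[p]) ^ 2 ∣ f 1 - f 0)
    (h0 : (p : ℤ_[p]) ∣ f 0) (m : ℕ) : ∃ k < p ^ m, (p : ℤ_[p]) ^ (m + 1) ∣ f k := by
  obtain ⟨c, hc, hc'⟩ := hf.exists_isUnit_slope hs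
  induction m with
  | zero => exact ⟨0, by simp, by simpa using h0⟩
  | succ m ih =>
    obtain ⟨k, hk, t, ht⟩ := ih
    -- Hensel step: `f (k + p ^ m j) ≡ p ^ (m + 1) (t + j c)` modulo `p ^ (m + 2)`, so the new digit
    -- is `j ≡ -t / c` modulo `p`.
    obtain ⟨w, hw⟩ := hc.exists_right_inv
    set j := (-(t * w)).zmodRepr
    have hj : j < p := PadicInt.zmodRepr_lt_p _
    have hj2 : (p : ℤ_[p]) ∣ -(t * w) - j := by
      rw [← PadicInt.norm_lt_one_iff_dvd]
      exact PadicInt.norm_sub_zmodRepr_lt_one _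
    refine ⟨k + p ^ m * j, ?_, ?_⟩
    · calc k + p ^ m * j < p ^ m + p ^ m * j := by omega
        _ = p ^ m * (j + 1) := by ring
        _ ≤ p ^ m * p := Nat.mul_le_mul_left _ hj
        _ = p ^ (m + 1) := (pow_succ _ _).symm
    · obtain ⟨b, hb⟩ := hf.affine k (p ^ m * j)
      obtain ⟨q, hq⟩ := hj2
      push_cast at hb
      refine ⟨-(q * c) + j * b, ?_⟩
      linear_combination hb + ht + (p : ℤ_[p]) ^ m * j * hc' -
        (p : ℤ_[p]) ^ (m + 1) * c * hq - (p : ℤ_[p]) ^ (m + 1) * t * hw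

end IsKummerAffine

/-! ### Irregular pairs and sequences in terms of the interpolating function -/

namespace BernoulliStructure

theorem powDvd_iff_norm_le (p : ℕ) [Fact p.Prime] (m : ℕ) (q : ℚ) :
    PowDvd p m q ↔ ‖(q : ℚ_[p])‖ ≤ (p : ℝ) ^ (-(m : ℤ)) := by
  have h : (p : ℝ) ^ (-(m : ℤ)) = (((p : ℚ) ^ (-(m : ℤ)) : ℚ) : ℝ) := by push_cast; rfl
  rw [PowDvd, Padic.eq_padicNorm, h, Rat.cast_le]

/-- The function `f` interpolates the divided Bernoulli numbers in the residue class of `l`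
modulo `p - 1`. -/
structure IsBernoulliInterpolation (p : ℕ) [Fact p.Prime] (l : ℕ) (f : ℕ → ℤ_[p]) : Prop
    extends IsKummerAffine p f where
  three_le : 3 ≤ p
  even : Even l
  two_le : 2 ≤ l
  lt : l < p - 1
  coe_eq : ∀ k, (f k : ℚ_[p]) =
    (1 - (p : ℚ_[p]) ^ (l + k * (p - 1) - 1)) * (dividedBernoulli (l + k * (p - 1)) : ℚ)

theorem norm_one_sub_pow (p : ℕ) [Fact p.Prime] (m : ℕ) (hm : 1 ≤ m) :
    ‖1 - (p : ℚ_[p]) ^ m‖ = 1 := by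
  have h : ‖(p : ℚ_[p]) ^ m‖ < 1 := by
    rw [norm_pow]
    exact pow_lt_one₀ (norm_nonneg _) Padic.norm_p_lt_one (by omega)
  rw [sub_eq_add_neg, Padic.add_eq_max_of_ne] <;> rw [norm_neg, norm_one]
  · exact max_eq_left h.le
  · exact h.ne'

/-- The digit `s_1` fixes the class modulo `p - 1`; the later digits are the base `p` digits of the
argument of `f`. -/
theorem sum_totient_eq (p : ℕ) (hp : p.Prime) (s : ℕ → ℕ) (t : ℕ) :
    ∑ i : Fin (t + 1), s i * Nat.totient (p ^ (i : ℕ)) =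
      s 0 + (∑ i ∈ Finset.range t, s (i + 1) * p ^ i) * (p - 1) := by
  rw [Fin.sum_univ_eq_sum_range (fun i => s i * Nat.totient (p ^ i)) (t + 1),
    Finset.sum_range_succ']
  simp only [pow_zero, Nat.totient_one, mul_one, Nat.totient_prime_pow_succ hp]
  rw [add_comm, Finset.sum_mul]
  simp only [mul_assoc]

theorem sum_digits_lt (p : ℕ) (s : ℕ → ℕ) (hs : ∀ i, s i < p) (t : ℕ) :
    ∑ i ∈ Finset.range t, s (i + 1) * p ^ i < p ^ t := by
  induction t with
  | zero => simp
  | succ t ih =>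
    rw [Finset.sum_range_succ]
    calc _ < p ^ t + s (t + 1) * p ^ t := by omega
      _ = (s (t + 1) + 1) * p ^ t := by ring
      _ ≤ p * p ^ t := Nat.mul_le_mul_right _ (hs _)
      _ = p ^ (t + 1) := (pow_succ' _ _).symm

namespace IsBernoulliInterpolation
variable {p : ℕ} [Fact p.Prime] {l : ℕ} {f : ℕ → ℤ_[p]}

theorem norm_eq (hf : IsBernoulliInterpolation p l f) (k : ℕ) :
    ‖f k‖ = ‖((dividedBernoulli (l + k * (p - 1)) : ℚ) : ℚ_[p])‖ := by
  have := hf.two_le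
  rw [PadicInt.norm_def, hf.coe_eq, norm_mul, norm_one_sub_pow p _ (by omega), one_mul]

theorem powDvd_iff (hf : IsBernoulliInterpolation p l f) (m k : ℕ) :
    PowDvd p m (dividedBernoulli (l + k * (p - 1))) ↔ (p : ℤ_[p]) ^ m ∣ f k := by
  rw [powDvd_iff_norm_le, PadicInt.pow_dvd_iff_norm_le, hf.norm_eq]

theorem odd (hf : IsBernoulliInterpolation p l f) : Odd p :=
  (Fact.out : p.Prime).odd_of_ne_two (by have := hf.three_le; omega)

theorem even_sub_one (hf : IsBernoulliInterpolation p l f) : Even (p - 1) := by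
  obtain ⟨c, hc⟩ := hf.odd
  exact ⟨c, by omega⟩

theorem add_three_le (hf : IsBernoulliInterpolation p l f) : l + 3 ≤ p := by
  obtain ⟨a, ha⟩ := hf.even
  obtain ⟨b, hb⟩ := hf.even_sub_one
  have := hf.lt
  omega

theorem add_mul_lt (hf : IsBernoulliInterpolation p l f) {t k : ℕ} (hk : k < p ^ t) :
    l + k * (p - 1) < p ^ t * (p - 1) :=
  calc l + k * (p - 1) < (p - 1) + k * (p - 1) := by have := hf.lt; omega
    _ = (k + 1) * (p - 1) := by ring
    _ ≤ p ^ t * (p - 1) := Nat.mul_le_mul_right _ hk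

theorem mem_irregularPairs_iff (hf : IsBernoulliInterpolation p l f) {t k : ℕ} (hk : k < p ^ t) :
    (p, l + k * (p - 1)) ∈ irregularPairs (t + 1) ↔ (p : ℤ_[p]) ^ (t + 1) ∣ f k := by
  have hpp : p.Prime := Fact.out
  rw [← hf.powDvd_iff]
  refine ⟨fun h => h.2.2.1, fun h => ⟨hpp, hf.odd, h, ?_, ?_, ?_⟩⟩
  · have := hf.two_le
    exact le_add_right this
  · simp only
    rw [Nat.totient_prime_pow_succ hpp]
    exact hf.add_mul_lt hk
  · exact hf.even.add (hf.even_sub_one.mul_left k)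

theorem mem_irregularPairs_one_iff (hf : IsBernoulliInterpolation p l f) :
    (p, l) ∈ irregularPairs 1 ↔ (p : ℤ_[p]) ∣ f 0 := by
  have := hf.mem_irregularPairs_iff (t := 0) (k := 0) (by simp)
  simpa using this

theorem mem_irregularTuples_iff (hf : IsBernoulliInterpolation p l f) (s : ℕ → ℕ) (hs0 : s 0 = l)
    (hs : ∀ i, s i < p) (t : ℕ) : (fun i : Fin (t + 1) => s i) ∈ irregularTuples p (t + 1) ↔
      (p : ℤ_[p]) ^ (t + 1) ∣ f (∑ i ∈ Finset.range t, s (i + 1) * p ^ i) := by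
  rw [← hf.mem_irregularPairs_iff (sum_digits_lt p s hs t), ← hs0,
    ← sum_totient_eq p Fact.out s t]
  refine ⟨fun h => h.2.2, fun h => ⟨fun i => hs i, fun i hi => ?_, h⟩⟩
  simp only [hi, hs0]
  exact ⟨hf.even, hf.two_le, hf.add_three_le⟩

theorem isIrregularSequence_iff (hf : IsBernoulliInterpolation p l f) (s : ℕ → ℕ) :
    IsIrregularSequence p l s ↔ s 0 = l ∧ (∀ i, s i < p) ∧
      ∀ t, (p : ℤ_[p]) ^ (t + 1) ∣ f (∑ i ∈ Finset.range t, s (i + 1) * p ^ i) := by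
  constructor
  · rintro ⟨h0, h⟩
    have hs : ∀ i, s i < p := fun i => (h (i + 1) (by omega)).1 ⟨i, by omega⟩
    exact ⟨h0, hs, fun t => (hf.mem_irregularTuples_iff s h0 hs t).mp (h (t + 1) (by omega))⟩
  · rintro ⟨h0, hs, h⟩
    refine ⟨h0, fun m hm => ?_⟩
    obtain ⟨t, rfl⟩ : ∃ t, m = t + 1 := ⟨m - 1, by omega⟩
    exact (hf.mem_irregularTuples_iff s h0 hs t).mpr (h t)

theorem existsUnique_isIrregularSequence (hf : IsBernoulliInterpolation p l f)
    (hs : ¬ (p : ℤ_[p]) ^ 2 ∣ f 1 - f 0) (h0 : (p : ℤ_[p]) ∣ f 0) :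
    ∃! s : ℕ → ℕ, IsIrregularSequence p l s := by
  have hpp : p.Prime := Fact.out
  choose K hK hKf using hf.exists_pow_dvd hs h0
  refine existsUnique_of_exists_of_unique ?_ ?_
  · let s : ℕ → ℕ := fun i => Nat.casesOn i l fun i => K (i + 1) / p ^ i
    have hsum : ∀ t, ∑ i ∈ Finset.range t, s (i + 1) * p ^ i = K t := by
      intro t
      induction t with
      | zero => have := hK 0; simp at this; simp [this]
      | succ t ih =>
        rw [Finset.sum_range_succ, ih]
        have h1 : K (t + 1) ≡ K t [MOD p ^ t] :=
          hf.modEq_of_pow_dvd hs ((pow_dvd_pow _ (by omega)).trans (hKf (t + 1))) (hKf t)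
        have h2 : K (t + 1) % p ^ t = K t := by
          rw [show K (t + 1) % p ^ t = K t % p ^ t from h1, Nat.mod_eq_of_lt (hK t)]
        have h3 := Nat.mod_add_div (K (t + 1)) (p ^ t)
        rw [h2, mul_comm] at h3
        exact h3
    refine ⟨s, (hf.isIrregularSequence_iff s).mpr ⟨rfl, ?_, fun t => ?_⟩⟩
    · rintro (_ | i)
      · have := hf.add_three_le
        show l < p
        omega
      · refine Nat.div_lt_of_lt_mul ?_
        rw [← pow_succ]
        exact hK (i + 1)
    · rw [hsum]
      exact hKf t
  · intro s s' h h'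
    rw [hf.isIrregularSequence_iff] at h h'
    obtain ⟨a0, a1, a2⟩ := h
    obtain ⟨b0, b1, b2⟩ := h'
    have hsum : ∀ t, ∑ i ∈ Finset.range t, s (i + 1) * p ^ i =
        ∑ i ∈ Finset.range t, s' (i + 1) * p ^ i := fun t =>
      Nat.ModEq.eq_of_lt_of_lt (hf.modEq_of_pow_dvd hs (a2 t) (b2 t)) (sum_digits_lt p s a1 t)
        (sum_digits_lt p s' b1 t)
    funext i
    rcases i with _ | i
    · rw [a0, b0]
    · have h1 := hsum (i + 1)
      rw [Finset.sum_range_succ, Finset.sum_range_succ, hsum i] at h1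
      exact Nat.eq_of_mul_eq_mul_right (pow_pos hpp.pos i) (Nat.add_left_cancel h1)

/-! ### The zero `χ` when `Δ ≠ 0` -/

open Filter Topology in
theorem pow_dvd_chi_sub (t : ℕ) :
    (p : ℤ_[p]) ^ t ∣ chi p l -
      ((∑ i ∈ Finset.range t, irregularSequence p l (i + 1) * p ^ i : ℕ) : ℤ_[p]) := by
  set s := irregularSequence p l
  have hsummable : Summable fun ν : ℕ => (s (ν + 1) : ℤ_[p]) * (p : ℤ_[p]) ^ ν := by
    have hp1 : ‖(p : ℤ_[p])‖ < 1 := by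
      rw [PadicInt.norm_lt_one_iff_dvd]
    refine Summable.of_norm_bounded (summable_geometric_of_lt_one (norm_nonneg _) hp1) fun ν => ?_
    rw [norm_mul, norm_pow]
    exact mul_le_of_le_one_left (by positivity) (PadicInt.norm_le_one _)
  have hlim := (hsummable.hasSum.tendsto_sum_nat).comp (tendsto_add_atTop_nat t)
  refine PadicInt.dvd_of_tendsto p _ _ _ (hlim.sub_const _) fun N => ?_
  simp only [Function.comp, add_comm N t, Finset.sum_range_add]
  push_cast
  rw [add_sub_cancel_left]
  refine Finset.dvd_sum fun i _ => ?_
  rw [pow_add]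
  exact Dvd.intro (s (t + i + 1) * (p : ℤ_[p]) ^ i) (by ring)

/-- The `t`-th partial sum of `χ` is a zero of `f` modulo `p ^ (t + 1)`. Compare `k` with it for `t
= m`, using uniqueness of zeros, and for `t = m + 1`, using continuity of `f`. -/
theorem chi_sub_exact (hf : IsBernoulliInterpolation p l f)
    (hs : ¬ (p : ℤ_[p]) ^ 2 ∣ f 1 - f 0) (h0 : (p : ℤ_[p]) ∣ f 0) (k m : ℕ)
    (h1 : (p : ℤ_[p]) ^ (m + 1) ∣ f k) (h2 : ¬ (p : ℤ_[p]) ^ (m + 2) ∣ f k) :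
    (p : ℤ_[p]) ^ m ∣ chi p l - k ∧ ¬ (p : ℤ_[p]) ^ (m + 1) ∣ chi p l - k := by
  have hseq : IsIrregularSequence p l (irregularSequence p l) :=
    Classical.epsilon_spec (hf.existsUnique_isIrregularSequence hs h0).exists
  obtain ⟨-, -, hsum⟩ := (hf.isIrregularSequence_iff _).mp hseq
  have hchi := fun t => pow_dvd_chi_sub (p := p) (l := l) t
  refine ⟨?_, fun h => h2 ?_⟩
  · have h3 := hf.modEq_of_pow_dvd hs h1 (hsum m)
    rw [← natCast_pow_dvd_sub_iff] at h3
    have := dvd_add (hchi m) h3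
    rwa [sub_add_sub_cancel] at this
  · have h3 := _root_.dvd_sub h (hchi (m + 1))
    rw [sub_sub_sub_cancel_left, natCast_pow_dvd_sub_iff] at h3
    exact (hf.pow_dvd_iff_of_modEq h3).mpr (hsum (m + 1))

/-! ### The tree when `Δ = 0` -/

theorem singularTree_imp (hf : IsBernoulliInterpolation p l f)
    (hs : (p : ℤ_[p]) ^ 2 ∣ f 1 - f 0) (h0 : (p : ℤ_[p]) ∣ f 0) {h l' : ℕ}
    (ht : SingularTree p l h l') :
    ∃ k, k < p ^ h ∧ l' = l + k * (p - 1) ∧ (p : ℤ_[p]) ^ (h + 1) ∣ f k := by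
  have hpp : p.Prime := Fact.out
  induction ht with
  | root => exact ⟨0, by simp, by simp, by simpa using h0⟩
  | child h l' j _ hmem hj ih =>
    obtain ⟨k, hk, rfl, -⟩ := ih
    have hk2 : k < p ^ (h + 1) := hk.trans_le (Nat.pow_le_pow_right hpp.pos (by omega))
    refine ⟨k + j * p ^ h, ?_, ?_, ?_⟩
    · calc k + j * p ^ h < p ^ h + j * p ^ h := by omega
        _ = (j + 1) * p ^ h := by ring
        _ ≤ p * p ^ h := Nat.mul_le_mul_right _ hj
        _ = p ^ (h + 1) := (pow_succ' _ _).symm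
    · rw [Nat.totient_prime_pow_succ hpp]
      ring
    -- The parent already has order `h + 2`, and the added digit does not change `k` modulo `p ^ h`,
    -- so every child inherits this order.
    · refine (hf.pow_dvd_iff_of_modEq_of_sq_dvd hs (m := h) (j := k) ?_).mpr
        ((hf.mem_irregularPairs_iff hk2).mp hmem)
      simp [Nat.ModEq]

/-- The path to the node follows the truncations `k % p ^ h`; each step appends the digit `k / p ^ h
% p`, and the truncation has the order needed to branch because `f` ignores that digit modulo `p ^
(h + 2)`. -/
theorem singularTree_of_pow_dvd (hf : IsBernoulliInterpolation p l f)
    (hs : (p : ℤ_[p]) ^ 2 ∣ f 1 - f 0) (h k : ℕ) (hk : (p : ℤ_[p]) ^ (h + 1) ∣ f k) :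
    SingularTree p l h (l + (k % p ^ h) * (p - 1)) := by
  have hpp : p.Prime := Fact.out
  induction h with
  | zero => simpa [Nat.mod_one] using SingularTree.root (p := p) (l := l)
  | succ h ih =>
    have h1 := ih ((pow_dvd_pow _ (by omega)).trans hk)
    have hlt : k % p ^ h < p ^ h := Nat.mod_lt _ (pow_pos hpp.pos _)
    have h2 : (p, l + (k % p ^ h) * (p - 1)) ∈ irregularPairs (h + 2) :=
      (hf.mem_irregularPairs_iff
        (hlt.trans_le (Nat.pow_le_pow_right hpp.pos (by omega : h ≤ h + 1)))).mpr
        ((hf.pow_dvd_iff_of_modEq_of_sq_dvd hs (Nat.mod_modEq k (p ^ h))).mpr hk)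
    have h3 := SingularTree.child h _ (k / p ^ h % p) h1 h2 (Nat.mod_lt _ hpp.pos)
    rw [Nat.totient_prime_pow_succ hpp] at h3
    convert h3 using 1
    rw [Nat.mod_pow_succ]
    ring

theorem mem_heightSet_iff (hf : IsBernoulliInterpolation p l f)
    (hs : (p : ℤ_[p]) ^ 2 ∣ f 1 - f 0) (h0 : (p : ℤ_[p]) ∣ f 0) (k h : ℕ) :
    h ∈ heightSet p (l + k * (p - 1)) ↔ (p : ℤ_[p]) ^ (h + 1) ∣ f k := by
  have hpp : p.Prime := Fact.out
  have hp1 : 0 < p - 1 := by have := hf.three_le; omega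
  have hmod : (l + k * (p - 1)) % (p - 1) = l := by
    rw [Nat.add_mul_mod_self_right, Nat.mod_eq_of_lt hf.lt]
  have hmod2 : (l + k * (p - 1)) % Nat.totient (p ^ (h + 1)) = l + (k % p ^ h) * (p - 1) := by
    rw [Nat.totient_prime_pow_succ hpp]
    conv_lhs => rw [← Nat.mod_add_div k (p ^ h)]
    rw [show l + (k % p ^ h + p ^ h * (k / p ^ h)) * (p - 1) =
      l + (k % p ^ h) * (p - 1) + p ^ h * (p - 1) * (k / p ^ h) by ring,
      Nat.add_mul_mod_self_left, Nat.mod_eq_of_lt]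
    exact hf.add_mul_lt (Nat.mod_lt _ (pow_pos hpp.pos _))
  rw [heightSet, Set.mem_ofPred_eq, hmod, hmod2]
  refine ⟨fun ht => ?_, hf.singularTree_of_pow_dvd hs h k⟩
  obtain ⟨k', _, hk', hd⟩ := hf.singularTree_imp hs h0 ht
  have : k % p ^ h = k' := Nat.eq_of_mul_eq_mul_right hp1 (Nat.add_left_cancel hk')
  rw [← this] at hd
  exact (hf.pow_dvd_iff_of_modEq (Nat.mod_modEq k (p ^ h))).mp hd

theorem isGreatest_heightSet (hf : IsBernoulliInterpolation p l f)
    (hs : (p : ℤ_[p]) ^ 2 ∣ f 1 - f 0) (h0 : (p : ℤ_[p]) ∣ f 0) (k m : ℕ)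
    (h1 : (p : ℤ_[p]) ^ (m + 1) ∣ f k) (h2 : ¬ (p : ℤ_[p]) ^ (m + 2) ∣ f k) :
    IsGreatest (heightSet p (l + k * (p - 1))) m := by
  refine ⟨(hf.mem_heightSet_iff hs h0 k m).mpr h1, fun h hh => ?_⟩
  rw [hf.mem_heightSet_iff hs h0] at hh
  by_contra hlt
  exact h2 ((pow_dvd_pow _ (by omega)).trans hh)

/-! ### The pair `(p, l, l)` and the residue `Δ` -/

theorem mem_irregularTuples_two_iff (hf : IsBernoulliInterpolation p l f) :
    ![l, l] ∈ irregularTuples p 2 ↔ (p : ℤ_[p]) ^ 2 ∣ f l := by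
  have h := hf.mem_irregularTuples_iff (fun _ => l) rfl
    (fun _ => by have := hf.add_three_le; omega) 1
  have h2 : (fun _ : Fin (1 + 1) => l) = ![l, l] := by
    funext i
    fin_cases i <;> rfl
  rw [h2] at h
  simpa using h

/-- Up to `p ^ 2`, the difference defining `Δ` does not see the Euler factors. -/
theorem dividedBernoulli_sub_eq (hf : IsBernoulliInterpolation p l f) (h0 : (p : ℤ_[p]) ∣ f 0) :
    ∃ z : ℤ_[p], ((dividedBernoulli (l + (p - 1)) - dividedBernoulli l : ℚ) : ℚ_[p]) =
      (f 1 - f 0 + (p : ℤ_[p]) ^ 2 * z : ℤ_[p]) := by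
  have hl := hf.two_le
  have hp := hf.three_le
  have hb : ∀ k, ∃ b : ℤ_[p], (b : ℚ_[p]) = (dividedBernoulli (l + k * (p - 1)) : ℚ) ∧
      f k = (1 - (p : ℤ_[p]) ^ (l + k * (p - 1) - 1)) * b := by
    intro k
    refine ⟨⟨_, (hf.norm_eq k).symm.trans_le (PadicInt.norm_le_one _)⟩, rfl, ?_⟩
    apply PadicInt.ext
    rw [hf.coe_eq]
    rfl
  obtain ⟨b0, hb0, hf0⟩ := hb 0
  obtain ⟨b1, hb1, hf1⟩ := hb 1
  rw [zero_mul, add_zero] at hb0 hf0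
  rw [one_mul] at hb1 hf1
  obtain ⟨c, hc⟩ : (p : ℤ_[p]) ∣ b0 := by
    have h := hf.norm_eq 0
    rw [zero_mul, add_zero, ← hb0, ← PadicInt.norm_def] at h
    rwa [← PadicInt.norm_lt_one_iff_dvd, ← h, PadicInt.norm_lt_one_iff_dvd]
  -- For `l = 2` the Euler term at `l` carries only one factor `p`; the second comes from `p ∣ b0`.
  -- The term at `l + p - 1` has exponent at least 2 by itself.
  obtain ⟨i, hi⟩ : ∃ i, l - 1 = i + 1 := ⟨l - 2, by omega⟩
  obtain ⟨j, hj⟩ : ∃ j, l + (p - 1) - 1 = j + 2 := ⟨l + (p - 1) - 3, by omega⟩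
  rw [hi] at hf0
  rw [hj] at hf1
  refine ⟨(p : ℤ_[p]) ^ j * b1 - (p : ℤ_[p]) ^ i * c, ?_⟩
  have h : b1 - b0 =
      f 1 - f 0 + (p : ℤ_[p]) ^ 2 * ((p : ℤ_[p]) ^ j * b1 - (p : ℤ_[p]) ^ i * c) := by
    rw [hf0, hf1, hc]
    ring
  rw [Rat.cast_sub, ← hb0, ← hb1, ← PadicInt.coe_sub, h]

theorem norm_deltaQuotient (hp : p.Prime) : ‖(deltaQuotient p 1 l : ℚ_[p])‖ =
    ‖((dividedBernoulli (l + (p - 1)) - dividedBernoulli l : ℚ) : ℚ_[p])‖ * p := by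
  simp only [deltaQuotient, pow_one]
  rw [Nat.totient_prime hp, Rat.cast_div, norm_div, Rat.cast_natCast, Padic.norm_p, div_inv_eq_mul]

theorem powDvd_zero_deltaQuotient (hf : IsBernoulliInterpolation p l f)
    (h0 : (p : ℤ_[p]) ∣ f 0) : PowDvd p 0 (deltaQuotient p 1 l) := by
  have hpp : p.Prime := Fact.out
  have hp0 : (0 : ℝ) < p := by exact_mod_cast hpp.pos
  obtain ⟨z, hz⟩ := hf.dividedBernoulli_sub_eq h0
  rw [powDvd_iff_norm_le, norm_deltaQuotient hpp, hz, ← PadicInt.norm_def]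
  have h1 : (p : ℤ_[p]) ^ 1 ∣ f 1 - f 0 + (p : ℤ_[p]) ^ 2 * z := by
    rw [pow_one]
    exact dvd_add hf.slope ((dvd_pow_self _ two_ne_zero).mul_right _)
  rw [PadicInt.pow_dvd_iff_norm_le] at h1
  calc _ ≤ (p : ℝ) ^ (-((1 : ℕ) : ℤ)) * p := mul_le_mul_of_nonneg_right h1 hp0.le
    _ = _ := by simp [hp0.ne']

theorem modPart_eq_zero_iff (q : ℚ) (hq : ‖(q : ℚ_[p])‖ ≤ 1) :
    PadicInt.modPart p q = 0 ↔ ‖(q : ℚ_[p])‖ < 1 := by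
  let x : ℤ_[p] := ⟨q, hq⟩
  have hx : ‖x‖ = ‖(q : ℚ_[p])‖ := rfl
  have h : ‖x - (PadicInt.modPart p q : ℤ)‖ < 1 := PadicInt.norm_sub_modPart (p := p) q hq
  rw [← hx]
  constructor
  · intro h0
    rwa [h0, Int.cast_zero, sub_zero] at h
  · intro hlt
    have h2 : ‖((PadicInt.modPart p q : ℤ) : ℤ_[p])‖ < 1 := by
      rw [PadicInt.norm_lt_one_iff_dvd] at h hlt ⊢
      simpa using _root_.dvd_sub hlt h
    rw [PadicInt.norm_int_lt_one_iff_dvd] at h2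
    exact Int.eq_zero_of_dvd_of_nonneg_of_lt (PadicInt.modPart_nonneg _)
      (PadicInt.modPart_lt_p _) h2

theorem delta_eq_zero_iff (hf : IsBernoulliInterpolation p l f) (h0 : (p : ℤ_[p]) ∣ f 0) :
    delta p 1 l = 0 ↔ (p : ℤ_[p]) ^ 2 ∣ f 1 - f 0 := by
  have hpp : p.Prime := Fact.out
  have hp0 : (0 : ℝ) < p := by exact_mod_cast hpp.pos
  have h1 := hf.powDvd_zero_deltaQuotient h0
  rw [powDvd_iff_norm_le] at h1
  obtain ⟨z, hz⟩ := hf.dividedBernoulli_sub_eq h0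
  rw [delta, modPart_eq_zero_iff _ (by simpa using h1), norm_deltaQuotient hpp, hz,
    ← PadicInt.norm_def, ← dvd_add_left (dvd_mul_right ((p : ℤ_[p]) ^ 2) z),
    PadicInt.pow_dvd_iff_norm_le, PadicInt.norm_le_pow_iff_norm_lt_pow_add_one,
    ← lt_div_iff₀ hp0, one_div]
  norm_num

end IsBernoulliInterpolation

theorem exists_isBernoulliInterpolation (p : ℕ) [Fact p.Prime] (l : ℕ) (hl2 : Even l)
    (hl0 : 0 < l) (hl1 : l < p - 1) :
    ∃ f : ℕ → ℤ_[p], IsBernoulliInterpolation p l f := by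
  obtain ⟨f, hf, hc⟩ := exists_isKummerAffine_bernoulli p (by omega) l hl0
    (Nat.not_dvd_of_pos_of_lt hl0 hl1)
  refine ⟨f, hf, by omega, hl2, ?_, hl1, fun k => ?_⟩
  · obtain ⟨c, rfl⟩ := hl2
    omega
  · rw [hc, dividedBernoulli]
    push_cast
    rfl

end BernoulliStructure

/-! ### From `B_n / n` to `B_n`, and the theorem -/

namespace BernoulliStructure

theorem exactPowDvd_bernoulli (n p r : ℕ) [Fact p.Prime] (hn : 0 < n) (hr : p ^ r ∣ n)
    (hr' : ¬ p ^ (r + 1) ∣ n) (δ : ℕ) (h1 : PowDvd p δ (dividedBernoulli n))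
    (h2 : ¬ PowDvd p (δ + 1) (dividedBernoulli n)) : ExactPowDvd p (r + δ) (bernoulli n) := by
  have hp0 : (0 : ℝ) < p := by exact_mod_cast (Fact.out : p.Prime).pos
  have hval : padicValNat p n = r := by
    have a := (padicValNat_dvd_iff_le hn.ne').mp hr
    have b := mt (padicValNat_dvd_iff_le hn.ne').mpr hr'
    omega
  have hnorm : ‖(n : ℚ_[p])‖ = (p : ℝ) ^ (-(r : ℤ)) := by
    rw [Padic.norm_eq_zpow_neg_valuation (by exact_mod_cast hn.ne'), Padic.valuation_natCast, hval]
  have key : ∀ m : ℕ, PowDvd p (r + m) (bernoulli n) ↔ PowDvd p m (dividedBernoulli n) := by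
    intro m
    have hb : bernoulli n = n * dividedBernoulli n := by
      have : (n : ℚ) ≠ 0 := by exact_mod_cast hn.ne'
      rw [dividedBernoulli]
      field_simp
    rw [powDvd_iff_norm_le, powDvd_iff_norm_le, hb, Rat.cast_mul, Rat.cast_natCast, norm_mul, hnorm,
      Nat.cast_add, neg_add, zpow_add₀ hp0.ne', mul_le_mul_iff_right₀ (zpow_pos hp0 _)]
  exact ⟨(key δ).mpr h1, mt (key (δ + 1)).mp h2⟩

theorem not_mem_irregularPairs_of_isRegularPrime {p l : ℕ} [Fact p.Prime] (hl0 : 0 < l)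
    (hl : l + 3 ≤ p) (hreg : IsRegularPrime p) : (p, l) ∉ irregularPairs 1 := by
  rintro ⟨-, -, h, h2, -, he⟩
  refine hreg.2.2 l he h2 hl ?_
  have hnd : ¬ p ∣ l := Nat.not_dvd_of_pos_of_lt hl0 (by omega)
  have h1 : ‖(l : ℚ_[p])‖ = 1 := by
    rw [Padic.norm_natCast_eq_one_iff]
    exact (Nat.Prime.coprime_iff_not_dvd Fact.out).mpr hnd
  simp only at h
  rw [powDvd_iff_norm_le, dividedBernoulli, Rat.cast_div, norm_div, Rat.cast_natCast, h1,
    div_one] at h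
  exact (powDvd_iff_norm_le _ _ _).mpr h

end BernoulliStructure

theorem mainTheorem3 (n p r l : ℕ) [Fact p.Prime]
    (hn : 0 < n) (hn2 : Even n)
    (hr : 1 ≤ r) (hpr : p ^ r ∣ n ∧ ¬ p ^ (r + 1) ∣ n)
    (hp : ¬ (p - 1) ∣ n)
    (hl : l ≡ n [MOD (p - 1)]) (hl0 : 0 < l) (hl1 : l < p - 1) :
    ∃ δ : ℕ,
      BernoulliStructure.ExactPowDvd p (r + δ) (bernoulli n) ∧
      -- case (1)
      (BernoulliStructure.IsRegularPrime p → δ = 0) ∧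
      -- case (2)
      (BernoulliStructure.IsIrregularPrime p →
        (p, l) ∉ BernoulliStructure.irregularPairs 1 → δ = 0) ∧
      -- in cases (3) and (4) the residue `Δ_{(p,l)}` is well defined
      ((p, l) ∈ BernoulliStructure.irregularPairs 1 →
        BernoulliStructure.PowDvd p 0 (BernoulliStructure.deltaQuotient p 1 l)) ∧
      -- case (3)
      (BernoulliStructure.IsIrregularPrime p →
        (p, l) ∈ BernoulliStructure.irregularPairs 1 →
        BernoulliStructure.delta p 1 l ≠ 0 →
          (∃! s : ℕ → ℕ, BernoulliStructure.IsIrregularSequence p l s) ∧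
          (BernoulliStructure.chi p l : ℚ_[p]) - ((n : ℚ_[p]) - (l : ℚ_[p])) / ((p : ℚ_[p]) - 1) ≠ 0 ∧
          (δ : ℤ) = 1 + Padic.valuation
            ((BernoulliStructure.chi p l : ℚ_[p]) - ((n : ℚ_[p]) - (l : ℚ_[p])) / ((p : ℚ_[p]) - 1))) ∧
      -- case (4)
      (BernoulliStructure.IsIrregularPrime p →
        (p, l) ∈ BernoulliStructure.irregularPairs 1 →
        BernoulliStructure.delta p 1 l = 0 →
          IsGreatest (BernoulliStructure.heightSet p n) (BernoulliStructure.h0 p n) ∧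
          δ = 1 + BernoulliStructure.h0 p n) ∧
      -- the addition to cases (3) and (4)
      (BernoulliStructure.IsIrregularPrime p →
        (p, l) ∈ BernoulliStructure.irregularPairs 1 →
          (![l, l] ∉ BernoulliStructure.irregularTuples p 2 → δ = 1) ∧
          (![l, l] ∈ BernoulliStructure.irregularTuples p 2 → 2 ≤ δ)) := by
  have hpp : p.Prime := Fact.out
  have hle : l ≤ n := by
    by_contra hlt
    rw [Nat.ModEq, Nat.mod_eq_of_lt hl1, Nat.mod_eq_of_lt (by omega)] at hl
    omega
  obtain ⟨k, hk⟩ : ∃ k, n = l + k * (p - 1) := by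
    obtain ⟨k, hk⟩ := (Nat.modEq_iff_dvd' hle).mp hl
    exact ⟨k, by rw [mul_comm k]; omega⟩
  have hodd : Odd p := hpp.odd_of_ne_two (by rintro rfl; exact hp (one_dvd _))
  have hl2 : Even l := by
    obtain ⟨c, hc⟩ := hodd
    have h1 : Even (k * (p - 1)) := Even.mul_left ⟨c, by omega⟩ k
    rw [hk] at hn2
    exact (Nat.even_add.mp hn2).mpr h1
  obtain ⟨f, hf⟩ := BernoulliStructure.exists_isBernoulliInterpolation p l hl2 hl0 hl1
  have hfk0 : f k ≠ 0 := by
    intro h0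
    have h1 := hf.norm_eq k
    rw [h0, norm_zero, ← hk, eq_comm, norm_eq_zero] at h1
    have h2 : BernoulliStructure.dividedBernoulli n = 0 := by exact_mod_cast h1
    rw [BernoulliStructure.dividedBernoulli, div_eq_zero_iff] at h2
    rcases h2 with h2 | h2
    · exact bernoulli_ne_zero_of_even n hn2 hn h2
    · exact hn.ne' (by exact_mod_cast h2)
  obtain ⟨δ, hδ1, hδ2⟩ := PadicInt.exists_exact_pow_dvd p (f k) hfk0
  have hdvd : (p : ℤ_[p]) ∣ f k ↔ (p, l) ∈ BernoulliStructure.irregularPairs 1 := by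
    rw [hf.mem_irregularPairs_one_iff]
    simpa using hf.pow_dvd_iff_of_modEq (k := k) (j := 0) (m := 0) (by simp [Nat.modEq_one])
  have hzero : (p, l) ∉ BernoulliStructure.irregularPairs 1 → δ = 0 := by
    intro h
    by_contra hδ
    exact h (hdvd.mp ((dvd_pow_self _ hδ).trans hδ1))
  have hpos : (p, l) ∈ BernoulliStructure.irregularPairs 1 → ∃ m, δ = m + 1 := by
    intro h
    refine Nat.exists_eq_succ_of_ne_zero ?_
    rintro rfl
    rw [zero_add, pow_one, hdvd] at hδ2
    exact hδ2 h
  -- As `p ∣ n` and `n = l + k (p - 1) ≡ l - k` modulo `p`, the second digit of `n` is `l` again.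
  have hkl : k ≡ l [MOD p ^ 1] := by
    have hpn : p ∣ n := (dvd_pow_self p (by omega)).trans hpr.1
    rw [pow_one, Nat.modEq_iff_dvd]
    obtain ⟨c, hc⟩ := hpn
    refine ⟨(c : ℤ) - k, ?_⟩
    have h1 : (n : ℤ) = l + k * (p - 1) := by
      rw [hk]
      push_cast [hpp.one_le]
      ring
    have h2 : (n : ℤ) = p * c := by exact_mod_cast hc
    linear_combination h2 - h1
  refine ⟨δ, BernoulliStructure.exactPowDvd_bernoulli n p r hn hpr.1 hpr.2 δ ?_ ?_, fun h => ?_,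
    fun _ => hzero, fun h => ?_, fun _ h hd => ?_, fun _ h hd => ?_, fun _ h => ⟨?_, ?_⟩⟩
  · rw [hk]
    exact (hf.powDvd_iff δ k).mpr hδ1
  · rw [hk]
    exact mt (hf.powDvd_iff (δ + 1) k).mp hδ2
  · exact hzero (BernoulliStructure.not_mem_irregularPairs_of_isRegularPrime hl0 hf.add_three_le h)
  · exact hf.powDvd_zero_deltaQuotient (hf.mem_irregularPairs_one_iff.mp h)
  · have h0 := hf.mem_irregularPairs_one_iff.mp h
    have hs := mt (hf.delta_eq_zero_iff h0).mpr hd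
    obtain ⟨m, rfl⟩ := hpos h
    obtain ⟨hc1, hc2⟩ := hf.chi_sub_exact hs h0 k m hδ1 hδ2
    have hquot : (BernoulliStructure.chi p l : ℚ_[p]) -
        ((n : ℚ_[p]) - (l : ℚ_[p])) / ((p : ℚ_[p]) - 1) =
        ((BernoulliStructure.chi p l - k : ℤ_[p]) : ℚ_[p]) := by
      have h1 : (p : ℚ_[p]) - 1 ≠ 0 := by
        rw [sub_ne_zero]
        exact_mod_cast hpp.one_lt.ne'
      rw [hk]
      push_cast [hpp.one_le]
      rw [add_sub_cancel_left, mul_div_cancel_right₀ _ h1]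
    refine ⟨hf.existsUnique_isIrregularSequence hs h0, ?_, ?_⟩
    · rw [hquot, PadicInt.coe_ne_zero]
      intro h1
      rw [h1] at hc2
      exact hc2 (dvd_zero _)
    · rw [hquot, PadicInt.valuation_coe, PadicInt.valuation_eq_of_dvd p m _ hc1 hc2]
      push_cast
      ring
  · have h0 := hf.mem_irregularPairs_one_iff.mp h
    have hs := (hf.delta_eq_zero_iff h0).mp hd
    obtain ⟨m, rfl⟩ := hpos h
    have hg := hf.isGreatest_heightSet hs h0 k m hδ1 hδ2
    rw [← hk] at hg
    have hh : BernoulliStructure.h0 p n = m := hg.csSup_eq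
    rw [hh]
    exact ⟨hg, add_comm _ _⟩
  · intro hn2
    rw [hf.mem_irregularTuples_two_iff, ← hf.pow_dvd_iff_of_modEq hkl] at hn2
    obtain ⟨m, rfl⟩ := hpos h
    by_contra hne
    exact hn2 ((pow_dvd_pow _ (by omega)).trans hδ1)
  · intro h2
    rw [hf.mem_irregularTuples_two_iff, ← hf.pow_dvd_iff_of_modEq hkl] at h2
    by_contra hlt
    exact hδ2 ((pow_dvd_pow _ (by omega)).trans h2)
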